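/- A knot is a regular simple closed $C^1$ curve in $\mathbb R^3$, considered up to ambient isotopy. A knot diagram $D$ is a regular closed $C^1$ curve in the plane whose only self-intersections are finitely many transverse double points (the crossings, whose number is denoted $c(D)$), together with the information at each crossing which of the two strands passes over the other. A bridge of length $l$ of $D$ is an arc of $D$ that makes exactly $l$ passes through crossings, all of them overpasses or all of them underpasses (i.e. $l$ consecutive overpasses, or $l$ consecutive underpasses). The unknotting number $u(K)$ of a knot $K$ is the least number of crossings that have to be switched in some diagram of $K$ (the minimum being taken over all diagrams of $K$) in order to obtain a diagram of the unknot. **Theorem.** Let $D$ be a diagram of a knot $K$ with a bridge of length $l=c(D)-k$. Then $$u(K)\le\lfloor k/2\rfloor .$$ -/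

import Mathlib

namespace KnotDiagram

/-- A knot: a closed `C¹` curve in three-space `ℝ³ = ℂ × ℝ`, parametrized by `ℝ/ℤ`, that is
regular (nowhere vanishing velocity) and has no self-intersections. -/
structure Knot where
  toFun : UnitAddCircle → ℂ × ℝ
  contDiff : ContDiff ℝ 1 (fun x : ℝ => toFun (x : UnitAddCircle))
  regular : ∀ x : ℝ, deriv (fun x : ℝ => toFun (x : UnitAddCircle)) x ≠ 0
  injective : Function.Injective toFun

/-- Equivalence of (unoriented) knots: there is an ambient isotopy of three-space, that is, a
continuous family of homeomorphisms starting at the identity, whose end carries the one curve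
onto the other. -/
def Isotopic (K L : Knot) : Prop :=
  ∃ Φ : unitInterval → ((ℂ × ℝ) ≃ₜ (ℂ × ℝ)),
    Continuous (fun q : unitInterval × (ℂ × ℝ) => Φ q.1 q.2) ∧
    Φ 0 = Homeomorph.refl (ℂ × ℝ) ∧
    Φ 1 '' Set.range K.toFun = Set.range L.toFun

theorem coe_toCircle (x : ℝ) : ((AddCircle.toCircle (x : UnitAddCircle) : Circle) : ℂ) =
    Complex.exp ((2 * Real.pi : ℝ) * Complex.I * x) := by
  rw [AddCircle.toCircle_apply_mk, Circle.coe_exp]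
  congr 1
  push_cast
  ring

theorem hasDerivAt_exp_circle (x : ℝ) :
    HasDerivAt (fun x : ℝ => (Complex.exp ((2 * Real.pi : ℝ) * Complex.I * x), (0 : ℝ)))
      (Complex.exp ((2 * Real.pi : ℝ) * Complex.I * x) * ((2 * Real.pi : ℝ) * Complex.I), 0) x := by
  have h1 : HasDerivAt (fun y : ℝ => ((2 * Real.pi : ℝ) : ℂ) * Complex.I * (y : ℂ))
      (((2 * Real.pi : ℝ) : ℂ) * Complex.I) x := by
    simpa using (Complex.ofRealCLM.hasDerivAt (x := x)).const_mul
      (((2 * Real.pi : ℝ) : ℂ) * Complex.I)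
  exact h1.cexp.prodMk (hasDerivAt_const x 0)

/-- The unknot: the round unit circle in a horizontal plane. -/
noncomputable def unknot : Knot where
  toFun t := (((AddCircle.toCircle t : Circle) : ℂ), 0)
  contDiff := by
    simp only [coe_toCircle]
    exact ((contDiff_const.mul Complex.ofRealCLM.contDiff).cexp).prodMk contDiff_const
  regular x := by
    simp only [coe_toCircle]
    rw [(hasDerivAt_exp_circle x).deriv]
    intro h
    have h := congrArg Prod.fst h
    simp [Real.pi_ne_zero] at h
  injective s t h :=
    AddCircle.injective_toCircle one_ne_zero (Circle.ext (congrArg Prod.fst h))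

/-- A generic closed curve in the plane `ℝ² = ℂ`: a regular closed `C¹` curve whose only
self-intersections are finitely many transverse double points. -/
structure PlaneCurve where
  toFun : UnitAddCircle → ℂ
  contDiff : ContDiff ℝ 1 (fun x : ℝ => toFun (x : UnitAddCircle))
  regular : ∀ x : ℝ, deriv (fun x : ℝ => toFun (x : UnitAddCircle)) x ≠ 0
  transverse : ∀ x y : ℝ, (x : UnitAddCircle) ≠ (y : UnitAddCircle) →
    toFun (x : UnitAddCircle) = toFun (y : UnitAddCircle) →
    LinearIndependent ℝ ![deriv (fun x : ℝ => toFun (x : UnitAddCircle)) x,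
      deriv (fun x : ℝ => toFun (x : UnitAddCircle)) y]
  no_triple : ∀ r s t : UnitAddCircle, r ≠ s → s ≠ t → r ≠ t →
    ¬ (toFun r = toFun s ∧ toFun s = toFun t)
  finite_crossings : {z : ℂ | ∃ s t : UnitAddCircle, s ≠ t ∧ toFun s = z ∧ toFun t = z}.Finite

/-- The crossings of the curve: its double points in the plane. -/
def PlaneCurve.crossings (C : PlaneCurve) : Set ℂ :=
  {z : ℂ | ∃ s t : UnitAddCircle, s ≠ t ∧ C.toFun s = z ∧ C.toFun t = z}

/-- The parameters at which the curve passes through a crossing, two for every crossing. -/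
def PlaneCurve.passes (C : PlaneCurve) : Set UnitAddCircle :=
  {t | ∃ s, s ≠ t ∧ C.toFun s = C.toFun t}

/-- A knot diagram: a generic closed plane curve together with the choice, at every crossing, of
the one of its two passes that is the overpass. -/
structure Diagram extends PlaneCurve where
  /-- The set of the parameters of the overpasses. -/
  overs : Set UnitAddCircle
  overs_subset : overs ⊆ toPlaneCurve.passes
  overs_iff : ∀ s t : UnitAddCircle, s ≠ t → toFun s = toFun t → (s ∈ overs ↔ t ∉ overs)

namespace Diagram

/-- The number `c(D)` of crossings. -/
noncomputable def crossingNumber (D : Diagram) : ℕ := D.crossings.ncard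

/-- `D` is a diagram of the knot `K`: there is a knot `L` isotopic to `K` whose vertical
projection is the curve of `D`, and which at every crossing of `D` is higher on the overpass than
on the underpass. -/
def IsDiagramOf (D : Diagram) (K : Knot) : Prop :=
  ∃ L : Knot, (∀ t, (L.toFun t).1 = D.toFun t) ∧
    (∀ s t, s ≠ t → D.toFun s = D.toFun t → s ∈ D.overs → (L.toFun t).2 < (L.toFun s).2) ∧
    Isotopic L K

/-- `D` has a bridge of length `l`: an arc of the diagram that makes exactly `l` passes through
crossings, all of them overpasses or all of them underpasses. -/
def HasBridge (D : Diagram) (l : ℕ) : Prop :=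
  ∃ a b : ℝ, a ≤ b ∧ b < a + 1 ∧
    (((fun x : ℝ => (x : UnitAddCircle)) '' Set.Icc a b) ∩ D.passes).encard = l ∧
    (((fun x : ℝ => (x : UnitAddCircle)) '' Set.Icc a b) ∩ D.passes ⊆ D.overs ∨
      ((fun x : ℝ => (x : UnitAddCircle)) '' Set.Icc a b) ∩ D.passes ⊆ D.passes \ D.overs)

/-- The diagram obtained by switching the crossings in the set `S`. -/
def switch (D : Diagram) (S : Set ℂ) : Diagram where
  toPlaneCurve := D.toPlaneCurve
  overs := {t | t ∈ D.passes ∧ (t ∈ D.overs ↔ D.toFun t ∉ S)}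
  overs_subset := fun _ ht => ht.1
  overs_iff := by
    intro s t hst h
    have hs : s ∈ D.passes := ⟨t, hst.symm, h.symm⟩
    have ht : t ∈ D.passes := ⟨s, hst, h⟩
    have := D.overs_iff s t hst h
    simp only [Set.mem_ofPred_eq, hs, ht, true_and, h]
    tauto

end Diagram

/-- The unknotting number `u(K)`: the least number of crossings that have to be switched in some
diagram of `K` in order to obtain a diagram of the unknot. -/
noncomputable def unknottingNumber (K : Knot) : ℕ∞ :=
  sInf {n : ℕ∞ | ∃ D : Diagram, D.IsDiagramOf K ∧
    ∃ S : Set ℂ, S ⊆ D.crossings ∧ S.encard = n ∧ (D.switch S).IsDiagramOf unknot}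

end KnotDiagram

/-!
Suppose the bridge consists of overpasses; underpasses are treated symmetrically. Traverse the
diagram from a point just before the bridge and switch every crossing whose first pass is below:
the diagram becomes descending. Or traverse it up to a point just behind the bridge and switch every
crossing whose last pass is below: the diagram becomes ascending. Neither procedure touches a
crossing on the bridge, since the bridge is traversed first in the one and last in the other. At each
of the other `k` crossings both passes lie outside the bridge, both traversals meet them in the same
order, and exactly one of the two procedures switches the crossing. Hence one of
them switches at most `k / 2` crossings (`PlaneCurve.exists_few_exchanges`).

A descending or ascending diagram represents the unknot (`Diagram.isDiagramOf_unknot`). The height is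
chosen monotone on a long arc that contains all passes and monotone on the short complementary
arc; after a reparametrization by an angle `θ` (`exists_reparametrization`) the knot is
`(f θ, cos θ)`, with its maximum at `θ = 0` and its minimum at `θ = π`. Every level in between
contains exactly the two points with parameters `θ` and `-θ`. Writing `f` as the sum of its even part,
a function `β (cos θ)`, and its odd part, a product `A (cos θ) * sin θ` with `A` continuous and
nowhere zero (at the extrema because `f` has nonzero derivative there), one sees that the knot is the
image of the vertical circle `(sin θ, cos θ)` under the level-preserving homeomorphism
`(z, s) ↦ (A s * z + β s, s)` of space. Since `A` has a continuous logarithm, that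
homeomorphism is isotopic to the identity (`exists_isotopy_unknot`).
-/

namespace KnotDiagram

/-! ### Level-preserving ambient isotopies -/

theorem exists_continuous_log {a : ℝ → ℂ} (ha : Continuous a) (h0 : ∀ s, a s ≠ 0) :
    ∃ lam : ℝ → ℂ, Continuous lam ∧ ∀ s, Complex.exp (lam s) = a s := by
  obtain ⟨F, ⟨-, hF⟩, -⟩ := Complex.isCoveringMap_exp.existsUnique_continuousMap_lifts
    (⟨fun s => ⟨a s, h0 s⟩, by fun_prop⟩ : C(ℝ, {z : ℂ // z ≠ 0})) (0 : ℝ) (Complex.log (a 0))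
    (Subtype.ext (Complex.exp_log (h0 0)))
  exact ⟨F, F.continuous, fun s => congrArg Subtype.val (congrFun hF s)⟩

/-- The homeomorphism of space that on the level `s` is the inverse of the affine map
`z ↦ exp (τ * lam s) * z + τ * β s`. -/
noncomputable def levelAffine {lam β : ℝ → ℂ} (hlam : Continuous lam) (hβ : Continuous β)
    (τ : ℝ) : (ℂ × ℝ) ≃ₜ (ℂ × ℝ) where
  toFun x := (Complex.exp (-(τ * lam x.2)) * (x.1 - τ * β x.2), x.2)
  invFun x := (Complex.exp (τ * lam x.2) * x.1 + τ * β x.2, x.2)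
  left_inv x := by
    ext1
    · simp [← mul_assoc, ← Complex.exp_add]
    · rfl
  right_inv x := by
    ext1
    · simp [← mul_assoc, ← Complex.exp_add]
    · rfl
  continuous_toFun := by fun_prop
  continuous_invFun := by fun_prop

/-- The rotation of space by the angle `φ` about the real axis of `ℂ`. -/
noncomputable def tilt (φ : ℝ) : (ℂ × ℝ) ≃ₜ (ℂ × ℝ) where
  toFun x := ((x.1.re : ℂ) + ((x.1.im * Real.cos φ + x.2 * Real.sin φ : ℝ) : ℂ) * Complex.I,
    x.2 * Real.cos φ - x.1.im * Real.sin φ)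
  invFun x := ((x.1.re : ℂ) + ((x.1.im * Real.cos φ - x.2 * Real.sin φ : ℝ) : ℂ) * Complex.I,
    x.2 * Real.cos φ + x.1.im * Real.sin φ)
  left_inv x := by
    have := Real.sin_sq_add_cos_sq φ
    ext1
    · apply Complex.ext
      · simp
      · simp only [Complex.add_im, Complex.ofReal_im, Complex.im_ofReal_mul, Complex.I_im]
        linear_combination x.1.im * this
    · simp only [Complex.add_im, Complex.ofReal_im, Complex.im_ofReal_mul, Complex.I_im]
      linear_combination x.2 * this
  right_inv x := by
    have := Real.sin_sq_add_cos_sq φ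
    ext1
    · apply Complex.ext
      · simp
      · simp only [Complex.add_im, Complex.ofReal_im, Complex.im_ofReal_mul, Complex.I_im]
        linear_combination x.1.im * this
    · simp only [Complex.add_im, Complex.ofReal_im, Complex.im_ofReal_mul, Complex.I_im]
      linear_combination x.2 * this
  continuous_toFun := by fun_prop
  continuous_invFun := by fun_prop

theorem range_unknot :
    Set.range unknot.toFun = Set.range fun θ : ℝ => (Complex.exp (θ * Complex.I), (0 : ℝ)) := by
  ext x
  constructor
  · rintro ⟨t, rfl⟩
    induction t using QuotientAddGroup.induction_on with | H y =>
    refine ⟨2 * Real.pi * y, ?_⟩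
    change _ = ((AddCircle.toCircle (y : UnitAddCircle) : ℂ), (0 : ℝ))
    rw [coe_toCircle]
    push_cast
    ring_nf
  · rintro ⟨θ, rfl⟩
    refine ⟨((θ / (2 * Real.pi) : ℝ) : UnitAddCircle), ?_⟩
    change ((AddCircle.toCircle ((θ / (2 * Real.pi) : ℝ) : UnitAddCircle) : ℂ), (0 : ℝ)) = _
    rw [coe_toCircle]
    have := Real.pi_ne_zero
    congr 2
    push_cast
    field_simp

/-- A closed curve obtained from the vertical unit circle `(sin θ, cos θ)` by applying to each
level `s` an affine map `z ↦ exp (lam s) * z + β s` is carried to the round horizontal circle by an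
ambient isotopy: undo the affine maps while rotating the vertical circle into the
horizontal plane. -/
theorem exists_isotopy_of_levelAffine {lam β : ℝ → ℂ} (hlam : Continuous lam) (hβ : Continuous β)
    {f : ℝ → ℂ} (hf : ∀ θ, f θ = Complex.exp (lam (Real.cos θ)) * Real.sin θ + β (Real.cos θ)) :
    ∃ Φ : unitInterval → ((ℂ × ℝ) ≃ₜ (ℂ × ℝ)),
      Continuous (fun q : unitInterval × (ℂ × ℝ) => Φ q.1 q.2) ∧
      Φ 0 = Homeomorph.refl (ℂ × ℝ) ∧
      Φ 1 '' Set.range (fun θ => (f θ, Real.cos θ)) = Set.range unknot.toFun := by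
  refine ⟨fun τ => (levelAffine hlam hβ τ).trans (tilt (τ * (Real.pi / 2))), ?_, ?_, ?_⟩
  · simp only [levelAffine, tilt, Homeomorph.trans_apply, Homeomorph.homeomorph_mk_coe,
      Equiv.coe_fn_mk]
    fun_prop
  · ext x <;> simp [levelAffine, tilt]
  · rw [range_unknot, ← Set.range_comp]
    have key : ∀ θ, tilt (Real.pi / 2) (levelAffine hlam hβ 1 (f θ, Real.cos θ)) =
        (Complex.exp ((Real.pi / 2 - θ : ℝ) * Complex.I), (0 : ℝ)) := by
      intro θ
      have h1 : levelAffine hlam hβ 1 (f θ, Real.cos θ) = ((Real.sin θ : ℂ), Real.cos θ) := by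
        rw [hf]
        simp [levelAffine, ← mul_assoc, ← Complex.exp_add]
      rw [h1, Complex.exp_mul_I, ← Complex.ofReal_cos, ← Complex.ofReal_sin,
        Real.cos_pi_div_two_sub, Real.sin_pi_div_two_sub]
      simp [tilt, -Complex.ofReal_cos, -Complex.ofReal_sin]
    ext x
    constructor
    · rintro ⟨θ, rfl⟩
      refine ⟨Real.pi / 2 - θ, ?_⟩
      simpa using (key θ).symm
    · rintro ⟨θ, rfl⟩
      refine ⟨Real.pi / 2 - θ, ?_⟩
      simpa using key (Real.pi / 2 - θ)

/-! ### Curves with one maximum and one minimum -/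

/-- A function vanishing at `0` and `π`, with nonzero derivatives there, is
`θ * (θ - π)` times a continuous function that does not vanish at `0` and `π`. -/
theorem exists_eq_mul_of_zeros {g : ℝ → ℂ} (hg : Continuous g) (h0 : g 0 = 0)
    (hpi : g Real.pi = 0) (hd0 : DifferentiableAt ℝ g 0) (hdpi : DifferentiableAt ℝ g Real.pi)
    (h0' : deriv g 0 ≠ 0) (hpi' : deriv g Real.pi ≠ 0) :
    ∃ N : ℝ → ℂ, Continuous N ∧ (∀ θ, g θ = ((θ * (θ - Real.pi) : ℝ) : ℂ) * N θ) ∧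
      N 0 ≠ 0 ∧ N Real.pi ≠ 0 := by
  have hne : Real.pi ≠ 0 := Real.pi_ne_zero
  have hc1 : Continuous (dslope g 0) := continuousOn_univ.1
    ((continuousOn_dslope Filter.univ_mem).2 ⟨hg.continuousOn, hd0⟩)
  have hd1 : DifferentiableAt ℝ (dslope g 0) Real.pi := (differentiableAt_dslope_of_ne hne).2 hdpi
  have hc2 : Continuous (dslope (dslope g 0) Real.pi) := continuousOn_univ.1
    ((continuousOn_dslope Filter.univ_mem).2 ⟨hc1.continuousOn, hd1⟩)
  have h1 : ∀ θ, g θ = (θ : ℂ) * dslope g 0 θ := fun θ => by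
    simpa [h0] using (sub_smul_dslope g 0 θ).symm
  have h1pi : dslope g 0 Real.pi = 0 := by
    have := h1 Real.pi
    rw [hpi] at this
    simpa [hne] using this.symm
  have h2 : ∀ θ, dslope g 0 θ = ((θ - Real.pi : ℝ) : ℂ) * dslope (dslope g 0) Real.pi θ :=
    fun θ => by
      have := sub_smul_dslope (dslope g 0) Real.pi θ
      rw [h1pi, sub_zero, Complex.real_smul] at this
      exact this.symm
  refine ⟨dslope (dslope g 0) Real.pi, hc2, fun θ => ?_, ?_, ?_⟩
  · rw [h1, h2]
    push_cast
    ring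
  · intro h
    have := h2 0
    rw [h, mul_zero, dslope_same] at this
    exact h0' this
  · intro h
    rw [dslope_same] at h
    have hd : HasDerivAt (fun θ : ℝ => (θ : ℂ) * dslope g 0 θ)
        (1 * dslope g 0 Real.pi + (Real.pi : ℂ) * deriv (dslope g 0) Real.pi) Real.pi :=
      (Complex.ofRealCLM.hasDerivAt (x := Real.pi)).mul hd1.hasDerivAt
    rw [h, h1pi, ← funext h1] at hd
    exact hpi' (by simpa using hd.deriv)

/-- A closed space curve `(f θ, cos θ)` that meets every level strictly between its maximum
`θ = 0` and its minimum `θ = π` in two different points is unknotted. The odd part of `f` is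
`sin θ` times an even function without zeros (at the two extrema this is the regularity of `f`),
and even functions of `θ` are functions of `cos θ`. -/
theorem exists_isotopy_unknot {f : ℝ → ℂ} (hf : Continuous f)
    (hper : Function.Periodic f (2 * Real.pi))
    (hd0 : DifferentiableAt ℝ f 0) (hdpi : DifferentiableAt ℝ f Real.pi)
    (h0' : deriv f 0 ≠ 0) (hpi' : deriv f Real.pi ≠ 0)
    (hinj : ∀ θ, 0 < θ → θ < Real.pi → f θ ≠ f (-θ)) :
    ∃ Φ : unitInterval → ((ℂ × ℝ) ≃ₜ (ℂ × ℝ)),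
      Continuous (fun q : unitInterval × (ℂ × ℝ) => Φ q.1 q.2) ∧
      Φ 0 = Homeomorph.refl (ℂ × ℝ) ∧
      Φ 1 '' Set.range (fun θ => (f θ, Real.cos θ)) = Set.range unknot.toFun := by
  have hdm : HasDerivAt f (deriv f Real.pi) (-Real.pi) := by
    have h : HasDerivAt f (deriv f Real.pi) (-Real.pi + 2 * Real.pi) := by
      rw [show -Real.pi + 2 * Real.pi = Real.pi by ring]; exact hdpi.hasDerivAt
    have := h.comp_add_const (-Real.pi) (2 * Real.pi)
    rwa [funext hper] at this
  have hO0 : HasDerivAt (fun θ => (f θ - f (-θ)) / 2) (deriv f 0) 0 := by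
    have h : HasDerivAt f (deriv f 0) (-0) := by simpa using hd0.hasDerivAt
    refine ((hd0.hasDerivAt.sub
      (h.scomp (0 : ℝ) (hasDerivAt_neg (0 : ℝ)))).div_const 2).congr_deriv ?_
    rw [neg_one_smul]; ring
  have hOpi : HasDerivAt (fun θ => (f θ - f (-θ)) / 2) (deriv f Real.pi) Real.pi := by
    refine ((hdpi.hasDerivAt.sub
      (hdm.scomp Real.pi (hasDerivAt_neg Real.pi))).div_const 2).congr_deriv ?_
    rw [neg_one_smul]; ring
  obtain ⟨N, hN, hON, hN0, hNpi⟩ := exists_eq_mul_of_zeros (g := fun θ => (f θ - f (-θ)) / 2)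
    (by fun_prop) (by simp)
    (by rw [← hper (-Real.pi), show -Real.pi + 2 * Real.pi = Real.pi by ring]; simp)
    hO0.differentiableAt hOpi.differentiableAt (by rwa [hO0.deriv]) (by rwa [hOpi.deriv])
  have hs : ∀ θ : ℝ, HasDerivAt (fun θ : ℝ => (Real.sin θ : ℂ)) (Real.cos θ : ℂ) θ :=
    fun θ => (Real.hasDerivAt_sin θ).ofReal_comp
  obtain ⟨M, hM, hsM, hM0, hMpi⟩ := exists_eq_mul_of_zeros (g := fun θ => (Real.sin θ : ℂ))
    (by fun_prop) (by simp) (by simp) (hs 0).differentiableAt (hs Real.pi).differentiableAt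
    (by rw [(hs 0).deriv]; simp) (by rw [(hs Real.pi).deriv]; simp)
  have hne : ∀ θ : ℝ, 0 ≤ θ → θ ≤ Real.pi → N θ ≠ 0 ∧ M θ ≠ 0 := by
    intro θ h1 h2
    rcases h1.eq_or_lt with rfl | h1
    · exact ⟨hN0, hM0⟩
    rcases h2.eq_or_lt with rfl | h2
    · exact ⟨hNpi, hMpi⟩
    constructor
    · intro h
      have := hON θ
      simp only [h, mul_zero, div_eq_zero_iff, sub_eq_zero] at this
      exact hinj θ h1 h2 (by simpa using this)
    · intro h
      have := hsM θ
      rw [h, mul_zero] at this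
      exact (Real.sin_pos_of_pos_of_lt_pi h1 h2).ne' (by exact_mod_cast this)
  -- `N / M` is the continuous extension of the quotient of the odd part of `f` by `sin` to `[0, π]`;
  -- `arccos`, which is constant outside `[-1, 1]`, turns it into a function of all levels.
  obtain ⟨lam, hlam, hexp⟩ := exists_continuous_log
    (a := fun s => N (Real.arccos s) / M (Real.arccos s))
    ((hN.comp Real.continuous_arccos).div (hM.comp Real.continuous_arccos)
      fun s => (hne _ (Real.arccos_nonneg s) (Real.arccos_le_pi s)).2)
    fun s => div_ne_zero (hne _ (Real.arccos_nonneg s) (Real.arccos_le_pi s)).1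
      (hne _ (Real.arccos_nonneg s) (Real.arccos_le_pi s)).2
  refine exists_isotopy_of_levelAffine hlam
    (β := fun s => (f (Real.arccos s) + f (-Real.arccos s)) / 2)
    (by have := Real.continuous_arccos; fun_prop) ?_
  have hpos : ∀ θ : ℝ, 0 ≤ θ → θ ≤ Real.pi →
      Complex.exp (lam (Real.cos θ)) * Real.sin θ = (f θ - f (-θ)) / 2 := by
    intro θ h1 h2
    have hM' := (hne θ h1 h2).2
    rw [hexp, Real.arccos_cos h1 h2, hsM, hON θ]
    field_simp
  have hsymm : ∀ θ : ℝ, -Real.pi ≤ θ → θ ≤ Real.pi →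
      f θ = Complex.exp (lam (Real.cos θ)) * Real.sin θ +
        (f (Real.arccos (Real.cos θ)) + f (-Real.arccos (Real.cos θ))) / 2 := by
    intro θ h1 h2
    rcases le_total 0 θ with h | h
    · rw [hpos θ h h2, Real.arccos_cos h h2]
      ring
    · have := hpos (-θ) (by linarith) (by linarith)
      rw [Real.cos_neg, Real.sin_neg, neg_neg, Complex.ofReal_neg] at this
      have harc : Real.arccos (Real.cos θ) = -θ := by
        rw [← Real.cos_neg, Real.arccos_cos (by linarith) (by linarith)]
      rw [harc, neg_neg]
      linear_combination this
  intro θ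
  obtain ⟨n, hn⟩ : ∃ n : ℤ, θ - n * (2 * Real.pi) ∈ Set.Ico (-Real.pi) (-Real.pi + 2 * Real.pi) := by
    obtain ⟨n, hn, -⟩ := existsUnique_sub_zsmul_mem_Ico Real.two_pi_pos θ (-Real.pi)
    exact ⟨n, by simpa using hn⟩
  have := hsymm _ hn.1 (by linarith [hn.2])
  rwa [Real.cos_sub_int_mul_two_pi, Real.sin_sub_int_mul_two_pi, hper.sub_int_mul_eq] at this

/-! ### Reparametrizations of the circle -/

/-- Two arcs that divide the circle `ℝ/ℤ` are carried to the two half circles of `ℝ/2πℤ` by a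
diffeomorphism. It is the integral of a positive density which is modified separately
on the two arcs in order to give each of them the mass `π`. -/
theorem exists_reparametrization {p q : ℝ} (hpq : p < q) (hqp : q < p + 1) :
    ∃ ψ : ℝ → ℝ, ContDiff ℝ 1 ψ ∧ (∀ x, 0 < deriv ψ x) ∧ Function.Surjective ψ ∧
      (∀ x, ψ (x + 1) = ψ x + 2 * Real.pi) ∧ ψ p = 0 ∧ ψ q = Real.pi := by
  have hπ := Real.pi_gt_three
  -- `g` is positive on `(p, q)` and negative on `(q, p + 1)`.
  set g : ℝ → ℝ := fun x => Real.sin (Real.pi * (x - p)) * Real.sin (Real.pi * (q - x)) with hg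
  have hgc : Continuous g := by fun_prop
  have hgper : ∀ x, g (x + 1) = g x := by
    intro x
    simp only [hg]
    rw [show Real.pi * (x + 1 - p) = Real.pi * (x - p) + Real.pi by ring,
      show Real.pi * (q - (x + 1)) = Real.pi * (q - x) - Real.pi by ring,
      Real.sin_add_pi, Real.sin_sub_pi]
    ring
  have hsin : ∀ y : ℝ, 0 < y → y < 1 → 0 < Real.sin (Real.pi * y) := fun y h0 h1 =>
    Real.sin_pos_of_pos_of_lt_pi (by positivity) (by nlinarith)
  have hgpos : ∀ x ∈ Set.Ioo p q, 0 < g x := fun x hx =>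
    mul_pos (hsin _ (by linarith [hx.1]) (by linarith [hx.2]))
      (hsin _ (by linarith [hx.2]) (by linarith [hx.1]))
  have hgneg : ∀ x ∈ Set.Ioo q (p + 1), 0 < -g x := by
    intro x hx
    have h := mul_pos (hsin (x - p) (by linarith [hx.1]) (by linarith [hx.2]))
      (hsin (x - q) (by linarith [hx.1]) (by linarith [hx.2]))
    rw [show x - q = -(q - x) by ring, mul_neg Real.pi, Real.sin_neg] at h
    simp only [hg]
    linarith
  have hint1 : ∀ a b : ℝ, IntervalIntegrable (fun x => max (g x) 0) MeasureTheory.volume a b :=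
    fun a b => (by fun_prop : Continuous fun x => max (g x) 0).intervalIntegrable a b
  have hint2 : ∀ a b : ℝ, IntervalIntegrable (fun x => max (-g x) 0) MeasureTheory.volume a b :=
    fun a b => (by fun_prop : Continuous fun x => max (-g x) 0).intervalIntegrable a b
  have hJ1 : 0 < ∫ x in p..q, max (g x) 0 :=
    intervalIntegral.intervalIntegral_pos_of_pos_on (hint1 _ _)
      (fun x hx => lt_max_of_lt_left (hgpos x hx)) hpq
  have hJ2 : 0 < ∫ x in q..(p + 1), max (-g x) 0 :=
    intervalIntegral.intervalIntegral_pos_of_pos_on (hint2 _ _)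
      (fun x hx => lt_max_of_lt_left (hgneg x hx)) hqp
  have hZ1 : ∫ x in p..q, max (-g x) 0 = 0 := by
    rw [intervalIntegral.integral_of_le hpq.le, MeasureTheory.integral_Ioc_eq_integral_Ioo]
    exact MeasureTheory.setIntegral_eq_zero_of_forall_eq_zero
      fun x hx => max_eq_right (by linarith [hgpos x hx])
  have hZ2 : ∫ x in q..(p + 1), max (g x) 0 = 0 := by
    rw [intervalIntegral.integral_of_le hqp.le, MeasureTheory.integral_Ioc_eq_integral_Ioo]
    exact MeasureTheory.setIntegral_eq_zero_of_forall_eq_zero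
      fun x hx => max_eq_right (by linarith [hgneg x hx])
  obtain ⟨J1, hJ1e⟩ : ∃ J, J = ∫ x in p..q, max (g x) 0 := ⟨_, rfl⟩
  obtain ⟨J2, hJ2e⟩ : ∃ J, J = ∫ x in q..(p + 1), max (-g x) 0 := ⟨_, rfl⟩
  rw [← hJ1e] at hJ1
  rw [← hJ2e] at hJ2
  set d1 : ℝ := (Real.pi - (q - p)) / J1 with hd1
  set d2 : ℝ := (Real.pi - (p + 1 - q)) / J2 with hd2
  have hd1pos : 0 < d1 := div_pos (by linarith) hJ1
  have hd2pos : 0 < d2 := div_pos (by linarith) hJ2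
  set ρ : ℝ → ℝ := fun x => 1 + d1 * max (g x) 0 + d2 * max (-g x) 0 with hρ
  have hρc : Continuous ρ := by fun_prop
  have hρ1 : ∀ x, 1 ≤ ρ x := fun x => by
    have h1 := mul_nonneg hd1pos.le (le_max_right (g x) 0)
    have h2 := mul_nonneg hd2pos.le (le_max_right (-g x) 0)
    simp only [hρ]
    linarith
  have hρper : Function.Periodic ρ 1 := fun x => by simp only [hρ, hgper]
  have hI : ∀ a b : ℝ, IntervalIntegrable ρ MeasureTheory.volume a b := hρc.intervalIntegrable
  have hρint : ∀ a b : ℝ, ∫ x in a..b, ρ x =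
      (b - a) + d1 * (∫ x in a..b, max (g x) 0) + d2 * ∫ x in a..b, max (-g x) 0 := by
    intro a b
    simp only [hρ]
    rw [intervalIntegral.integral_add
        ((intervalIntegrable_const).add ((hint1 a b).const_mul d1)) ((hint2 a b).const_mul d2),
      intervalIntegral.integral_add intervalIntegrable_const ((hint1 a b).const_mul d1),
      intervalIntegral.integral_const_mul, intervalIntegral.integral_const_mul]
    simp
  have hpqint : ∫ x in p..q, ρ x = Real.pi := by
    rw [hρint, hZ1, ← hJ1e, hd1]
    field_simp
    ring
  have hqpint : ∫ x in q..(p + 1), ρ x = Real.pi := by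
    rw [hρint, hZ2, ← hJ2e, hd2]
    field_simp
    ring
  have hderiv : ∀ x, HasDerivAt (fun x => ∫ y in p..x, ρ y) (ρ x) x := fun x =>
    (hρc.integral_hasStrictDerivAt p x).hasDerivAt
  have hdiff : Differentiable ℝ (fun x => ∫ y in p..x, ρ y) :=
    fun x => (hderiv x).differentiableAt
  have hmono : Monotone (fun x => (∫ y in p..x, ρ y) - x) := by
    refine monotone_of_deriv_nonneg (hdiff.sub differentiable_id) fun x => ?_
    have hd : HasDerivAt (fun x => (∫ y in p..x, ρ y) - x) (ρ x - 1) x :=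
      (hderiv x).sub (hasDerivAt_id' x)
    rw [hd.deriv]
    linarith [hρ1 x]
  refine ⟨fun x => ∫ y in p..x, ρ y, ?_, ?_, ?_, ?_, ?_, hpqint⟩
  · rw [contDiff_one_iff_deriv]
    exact ⟨hdiff, by rwa [funext fun x => (hderiv x).deriv]⟩
  · intro x
    rw [(hderiv x).deriv]
    linarith [hρ1 x]
  · refine hdiff.continuous.surjective ?_ ?_
    · refine Filter.tendsto_atTop_mono' _ ?_ (Filter.tendsto_atTop_add_const_right _
        (∫ y in p..0, ρ y) Filter.tendsto_id)
      filter_upwards [Filter.eventually_ge_atTop 0] with x hx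
      have := hmono hx
      simp only [id] at this ⊢
      linarith
    · refine Filter.tendsto_atBot_mono' _ ?_ (Filter.tendsto_atBot_add_const_right _
        (∫ y in p..0, ρ y) Filter.tendsto_id)
      filter_upwards [Filter.eventually_le_atBot 0] with x hx
      have := hmono hx
      simp only [id] at this ⊢
      linarith
  · intro x
    have h1 := intervalIntegral.integral_add_adjacent_intervals (hI p x) (hI x (x + 1))
    have h2 := intervalIntegral.integral_add_adjacent_intervals (hI p q) (hI q (p + 1))
    have h3 := hρper.intervalIntegral_add_eq x p
    dsimp only
    linarith
  · exact intervalIntegral.integral_same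

/-! ### Descending and ascending diagrams -/

theorem coe_ne_coe_of_lt {x y : ℝ} (h : x < y) (h1 : y < x + 1) :
    (x : UnitAddCircle) ≠ (y : UnitAddCircle) := by
  intro h2
  have := (AddCircle.coe_eq_coe_iff_of_mem_Ico (p := (1 : ℝ)) (a := x) ⟨le_rfl, by linarith⟩
    ⟨h.le, h1⟩).1 h2
  exact h.ne this

theorem PlaneCurve.continuous_comp_coe (C : PlaneCurve) :
    Continuous fun x : ℝ => C.toFun (x : UnitAddCircle) := C.contDiff.continuous

/-- The knot that lies over a plane curve with a given height function. -/
noncomputable def PlaneCurve.lift (C : PlaneCurve) (h : ℝ → ℝ) (hper : Function.Periodic h 1)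
    (hC : ContDiff ℝ 1 h)
    (hne : ∀ x y : ℝ, (x : UnitAddCircle) ≠ (y : UnitAddCircle) →
      C.toFun (x : UnitAddCircle) = C.toFun (y : UnitAddCircle) → h x ≠ h y) : Knot where
  toFun t := (C.toFun t, hper.lift t)
  contDiff := C.contDiff.prodMk hC
  regular x hx := by
    have h1 := (C.contDiff.differentiable one_ne_zero x).hasDerivAt.prodMk
      (hC.differentiable one_ne_zero x).hasDerivAt
    have h2 : deriv (fun x : ℝ => (C.toFun (x : UnitAddCircle), hper.lift (x : UnitAddCircle))) x =
      _ := h1.deriv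
    rw [h2] at hx
    exact C.regular x (congrArg Prod.fst hx)
  injective s t hst := by
    induction s using QuotientAddGroup.induction_on with | H x =>
    induction t using QuotientAddGroup.induction_on with | H y =>
    by_contra hxy
    exact hne x y hxy (congrArg Prod.fst hst) (congrArg Prod.snd hst)

/-- If all passes of `C` lie on an arc `[p, q]`, which the reparametrization `ψ` carries to a half
circle, then the space curve over `C` with height `cos ψ`, or with height `cos (ψ + π) = -cos ψ`,
is unknotted. -/
theorem PlaneCurve.exists_isotopy_reparametrization (C : PlaneCurve) {p q : ℝ}
    (hpass : C.passes ⊆ (fun x : ℝ => (x : UnitAddCircle)) '' Set.Icc p q)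
    {ψ : ℝ → ℝ} (hψ : ContDiff ℝ 1 ψ) (hψ' : ∀ x, 0 < deriv ψ x)
    (hsurj : Function.Surjective ψ) (hψ1 : ∀ x, ψ (x + 1) = ψ x + 2 * Real.pi)
    (hψp : ψ p = 0) (hψq : ψ q = Real.pi) {c : ℝ} (hc : c = 0 ∨ c = Real.pi) :
    ∃ Φ : unitInterval → ((ℂ × ℝ) ≃ₜ (ℂ × ℝ)),
      Continuous (fun q : unitInterval × (ℂ × ℝ) => Φ q.1 q.2) ∧
      Φ 0 = Homeomorph.refl (ℂ × ℝ) ∧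
      Φ 1 '' Set.range (fun x : ℝ => (C.toFun (x : UnitAddCircle), Real.cos (ψ x + c))) =
        Set.range unknot.toFun := by
  have hmono : StrictMono ψ := strictMono_of_deriv_pos hψ'
  set e : ℝ ≃ₜ ℝ := (hmono.orderIsoOfSurjective ψ hsurj).toHomeomorph with he
  have hψe : ∀ θ, ψ (e.symm θ) = θ := fun θ => e.apply_symm_apply θ
  have heψ : ∀ x, e.symm (ψ x) = x := fun x => e.symm_apply_apply x
  have heper : ∀ θ, e.symm (θ + 2 * Real.pi) = e.symm θ + 1 := fun θ => by
    apply hmono.injective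
    rw [hψ1, hψe, hψe]
  have hede : ∀ θ, HasDerivAt e.symm (deriv ψ (e.symm θ))⁻¹ θ := fun θ =>
    HasDerivAt.of_local_left_inverse e.symm.continuous.continuousAt
      (hψ.differentiable one_ne_zero _).hasDerivAt (hψ' _).ne' (Filter.Eventually.of_forall hψe)
  have hfper : Function.Periodic (fun θ => C.toFun (e.symm θ : UnitAddCircle)) (2 * Real.pi) := by
    intro θ
    simp only [heper, AddCircle.coe_add_period]
  have hfd : ∀ θ, HasDerivAt (fun θ => C.toFun (e.symm θ : UnitAddCircle))
      ((deriv ψ (e.symm θ))⁻¹ • deriv (fun x : ℝ => C.toFun (x : UnitAddCircle)) (e.symm θ)) θ :=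
    fun θ => HasDerivAt.scomp (h := e.symm) θ
      (C.contDiff.differentiable one_ne_zero (e.symm θ)).hasDerivAt (hede θ)
  -- The complementary arc is free of passes, so it does not meet the arc `[p, q]`.
  have hfne : ∀ u v, 0 < u → u < Real.pi → -Real.pi < v → v < 0 →
      C.toFun (e.symm u : UnitAddCircle) ≠ C.toFun (e.symm v : UnitAddCircle) := by
    intro u v hu0 hu1 hv0 hv1 h
    have hv2 : e.symm v < p := by
      rw [← hmono.lt_iff_lt, hψe, hψp]; exact hv1
    have hv3 : q < e.symm v + 1 := by
      rw [← hmono.lt_iff_lt, hψ1, hψe, hψq]; linarith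
    have huv : e.symm v < e.symm u := by
      rw [← hmono.lt_iff_lt, hψe, hψe]; linarith
    have huv1 : e.symm u < e.symm v + 1 := by
      rw [← hmono.lt_iff_lt, hψ1, hψe, hψe]; linarith
    obtain ⟨x, hx, hxv⟩ := hpass ⟨_, (coe_ne_coe_of_lt huv huv1).symm, h⟩
    exact coe_ne_coe_of_lt (hv2.trans_le hx.1) (hx.2.trans_lt hv3) hxv.symm
  have hmain := exists_isotopy_unknot (f := fun θ => C.toFun (e.symm (θ - c) : UnitAddCircle))
    (C.continuous_comp_coe.comp (e.symm.continuous.comp (continuous_sub_right c)))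
    (fun θ => by dsimp only; rw [add_sub_right_comm]; exact hfper (θ - c))
    ((hfd _).comp_sub_const 0 c).differentiableAt
    ((hfd _).comp_sub_const Real.pi c).differentiableAt
    (by rw [((hfd _).comp_sub_const 0 c).deriv]
        exact smul_ne_zero (inv_ne_zero (hψ' _).ne') (C.regular _))
    (by rw [((hfd _).comp_sub_const Real.pi c).deriv]
        exact smul_ne_zero (inv_ne_zero (hψ' _).ne') (C.regular _))
    (by
      intro θ h0 h1
      rcases hc with rfl | rfl
      · exact hfne _ _ (by linarith) (by linarith) (by linarith) (by linarith)
      · have := hfne (-θ - Real.pi + 2 * Real.pi) (θ - Real.pi) (by linarith) (by linarith)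
          (by linarith) (by linarith)
        rw [heper, AddCircle.coe_add_period] at this
        exact this.symm)
  suffices hrange : Set.range (fun x : ℝ => (C.toFun (x : UnitAddCircle), Real.cos (ψ x + c))) =
      Set.range fun θ => (C.toFun (e.symm (θ - c) : UnitAddCircle), Real.cos θ) by
    rwa [hrange]
  ext x
  constructor
  · rintro ⟨y, rfl⟩
    exact ⟨ψ y + c, by simp only [add_sub_cancel_right, heψ]⟩
  · rintro ⟨θ, rfl⟩
    exact ⟨e.symm (θ - c), by simp only [hψe, sub_add_cancel]⟩

/-- If an arc `[p, q]` shorter than the full circle contains all passes, and every crossing is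
passed first above and then below along this arc, or always first below and then above, then the
diagram is one of the unknot: give the curve a height that is monotone on `[p, q]` and
monotone on the complementary arc. -/
theorem Diagram.isDiagramOf_unknot (D : Diagram) {p q : ℝ} (hpq : p < q) (hqp : q < p + 1)
    (hpass : D.passes ⊆ (fun x : ℝ => (x : UnitAddCircle)) '' Set.Icc p q)
    (h : (∀ x ∈ Set.Icc p q, ∀ y ∈ Set.Icc p q, x < y →
        D.toFun (x : UnitAddCircle) = D.toFun (y : UnitAddCircle) →
        (x : UnitAddCircle) ∈ D.overs) ∨
      (∀ x ∈ Set.Icc p q, ∀ y ∈ Set.Icc p q, x < y →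
        D.toFun (x : UnitAddCircle) = D.toFun (y : UnitAddCircle) →
        (y : UnitAddCircle) ∈ D.overs)) :
    D.IsDiagramOf unknot := by
  obtain ⟨ψ, hψ, hψ', hsurj, hψ1, hψp, hψq⟩ := exists_reparametrization hpq hqp
  have hmono : StrictMono ψ := strictMono_of_deriv_pos hψ'
  obtain ⟨c, hc, hover⟩ : ∃ c : ℝ, (c = 0 ∨ c = Real.pi) ∧
      ∀ x ∈ Set.Icc p q, ∀ y ∈ Set.Icc p q, (x : UnitAddCircle) ≠ (y : UnitAddCircle) →
        D.toFun (x : UnitAddCircle) = D.toFun (y : UnitAddCircle) →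
        (x : UnitAddCircle) ∈ D.overs → Real.cos (ψ y + c) < Real.cos (ψ x + c) := by
    have hcos : ∀ x ∈ Set.Icc p q, ∀ y ∈ Set.Icc p q, x < y → Real.cos (ψ y) < Real.cos (ψ x) :=
      fun x hx y hy hxy => Real.cos_lt_cos_of_nonneg_of_le_pi
        (hψp ▸ hmono.monotone hx.1) (hψq ▸ hmono.monotone hy.2) (hmono hxy)
    rcases h with h | h
    · refine ⟨0, Or.inl rfl, fun x hx y hy hne hxy ho => ?_⟩
      rcases lt_trichotomy x y with hlt | rfl | hlt
      · simpa using hcos x hx y hy hlt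
      · exact absurd rfl hne
      · exact absurd (h y hy x hx hlt hxy.symm) ((D.overs_iff _ _ hne hxy).1 ho)
    · refine ⟨Real.pi, Or.inr rfl, fun x hx y hy hne hxy ho => ?_⟩
      rcases lt_trichotomy x y with hlt | rfl | hlt
      · exact absurd (h x hx y hy hlt hxy) ((D.overs_iff _ _ hne hxy).1 ho)
      · exact absurd rfl hne
      · simpa [Real.cos_add_pi] using hcos y hy x hx hlt
  have hper : Function.Periodic (fun x => Real.cos (ψ x + c)) 1 := fun x => by
    dsimp only
    rw [hψ1, add_right_comm, Real.cos_add_two_pi]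
  have hover' : ∀ s t : UnitAddCircle, s ≠ t → D.toFun s = D.toFun t → s ∈ D.overs →
      hper.lift t < hper.lift s := by
    intro s t hne hst ho
    obtain ⟨x, hx, rfl⟩ := hpass ⟨t, hne.symm, hst.symm⟩
    obtain ⟨y, hy, rfl⟩ := hpass ⟨_, hne, hst⟩
    exact hover x hx y hy hne hst ho
  have hne : ∀ x y : ℝ, (x : UnitAddCircle) ≠ (y : UnitAddCircle) →
      D.toFun (x : UnitAddCircle) = D.toFun (y : UnitAddCircle) →
      Real.cos (ψ x + c) ≠ Real.cos (ψ y + c) := by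
    intro x y hxy h
    by_cases ho : (x : UnitAddCircle) ∈ D.overs
    · exact (hover' _ _ hxy h ho).ne'
    · exact (hover' _ _ hxy.symm h.symm ((D.overs_iff _ _ hxy.symm h.symm).2 ho)).ne
  refine ⟨D.lift _ hper (Real.contDiff_cos.comp (hψ.add contDiff_const)) hne, fun _ => rfl,
    hover', ?_⟩
  obtain ⟨Φ, h1, h2, h3⟩ :=
    D.exists_isotopy_reparametrization hpass hψ hψ' hsurj hψ1 hψp hψq hc
  refine ⟨Φ, h1, h2, ?_⟩
  rw [← h3]
  congr 1
  exact (QuotientAddGroup.mk_surjective.range_comp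
    (D.lift _ hper (Real.contDiff_cos.comp (hψ.add contDiff_const)) hne).toFun).symm

/-! ### Counting the crossings to be switched -/

theorem PlaneCurve.eq_or_eq_of_fiber (C : PlaneCurve) {s t u : UnitAddCircle} (hst : s ≠ t)
    (h : C.toFun s = C.toFun t) (hu : C.toFun u = C.toFun s) : u = s ∨ u = t := by
  by_contra! hne
  exact C.no_triple u s t hne.1 hst hne.2 ⟨hu, h⟩

theorem PlaneCurve.finite_passes (C : PlaneCurve) : C.passes.Finite := by
  refine (C.finite_crossings.biUnion (t := fun z => C.toFun ⁻¹' {z}) ?_).subset ?_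
  · rintro z ⟨s, t, hst, rfl, ht⟩
    exact (Set.toFinite {s, t}).subset fun u hu => C.eq_or_eq_of_fiber hst ht.symm hu
  · rintro t ⟨s, hst, h⟩
    exact Set.mem_biUnion (x := C.toFun t) ⟨s, t, hst, h, rfl⟩ rfl

theorem exists_punctured_ball_coe_notMem {P : Set UnitAddCircle} (hP : P.Finite) (a : ℝ) :
    ∃ ε > 0, ε < 1 ∧ ∀ x : ℝ, |x - a| < ε → x ≠ a → (x : UnitAddCircle) ∉ P := by
  have h : ∀ᶠ x : ℝ in nhds a, x ≠ a → (x : UnitAddCircle) ∉ P := by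
    have h1 : ∀ t ∈ P, ∀ᶠ x : ℝ in nhds a, x ≠ a → (x : UnitAddCircle) ≠ t := by
      intro t _
      by_cases hta : (a : UnitAddCircle) = t
      · filter_upwards [Metric.ball_mem_nhds a one_pos] with x hx hxa
        rw [Metric.mem_ball, Real.dist_eq, abs_lt] at hx
        rw [← hta]
        rcases hxa.lt_or_gt with h | h
        · exact coe_ne_coe_of_lt h (by linarith)
        · exact (coe_ne_coe_of_lt h (by linarith)).symm
      · filter_upwards [(AddCircle.continuous_mk' (1 : ℝ)).continuousAt.eventually_ne hta]
          with x hx _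
        exact hx
    filter_upwards [(Filter.eventually_all_finite hP).2 h1] with x hx hxa hxP
    exact hx _ hxP hxa rfl
  obtain ⟨ε, hε, h⟩ := Metric.eventually_nhds_iff.1 h
  refine ⟨min ε 2⁻¹, by positivity, (min_le_right _ _).trans_lt (by norm_num), fun x hx => h ?_⟩
  exact hx.trans_le (min_le_left _ _)

theorem eq_of_coe_eq {c x y : ℝ} (hx : c ≤ x) (hx' : x < c + 1) (hy : c ≤ y) (hy' : y < c + 1)
    (h : (x : UnitAddCircle) = (y : UnitAddCircle)) : x = y :=
  (AddCircle.coe_eq_coe_iff_of_mem_Ico (p := (1 : ℝ)) (a := c) ⟨hx, hx'⟩ ⟨hy, hy'⟩).1 h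

/-- Exchanging the passes at the crossings whose first pass along the arc `[p, q]` is not in `O`
makes `O` consist of first passes. -/
theorem PlaneCurve.first_mem_iff (C : PlaneCurve) {O : Set UnitAddCircle}
    {p q : ℝ} (hqp : q < p + 1) {x y : ℝ} (hx : x ∈ Set.Icc p q) (hy : y ∈ Set.Icc p q)
    (hxy : x < y) (h : C.toFun (x : UnitAddCircle) = C.toFun (y : UnitAddCircle)) :
    (x : UnitAddCircle) ∈ O ↔ C.toFun (x : UnitAddCircle) ∉
      {z | ∃ x ∈ Set.Icc p q, ∃ y ∈ Set.Icc p q, x < y ∧ C.toFun (x : UnitAddCircle) = z ∧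
        C.toFun (y : UnitAddCircle) = z ∧ (x : UnitAddCircle) ∉ O} := by
  have inj : ∀ u ∈ Set.Icc p q, ∀ v ∈ Set.Icc p q,
      (u : UnitAddCircle) = (v : UnitAddCircle) → u = v := fun u hu v hv =>
    eq_of_coe_eq hu.1 (hu.2.trans_lt hqp) hv.1 (hv.2.trans_lt hqp)
  have hne := coe_ne_coe_of_lt hxy (by linarith [hx.1, hy.2])
  refine ⟨?_, fun hn => ?_⟩
  · rintro ho ⟨x', hx', y', hy', hlt, h1, h2, hno⟩
    rcases C.eq_or_eq_of_fiber hne h h1 with e | e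
    · rw [e] at hno
      exact hno ho
    rcases C.eq_or_eq_of_fiber hne h h2 with e' | e'
    · have := inj _ hx' _ hy e
      have := inj _ hy' _ hx e'
      linarith
    · have := inj _ hx' _ hy e
      have := inj _ hy' _ hy e'
      linarith
  · by_contra ho
    exact hn ⟨x, hx, y, hy, hxy, rfl, h.symm, ho⟩

/-- Exchanging the passes at the crossings whose last pass along the arc `[p, q]` is not in `O`
makes `O` consist of last passes. -/
theorem PlaneCurve.last_mem_iff (C : PlaneCurve) {O : Set UnitAddCircle}
    {p q : ℝ} (hqp : q < p + 1) {x y : ℝ} (hx : x ∈ Set.Icc p q) (hy : y ∈ Set.Icc p q)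
    (hxy : x < y) (h : C.toFun (x : UnitAddCircle) = C.toFun (y : UnitAddCircle)) :
    (y : UnitAddCircle) ∈ O ↔ C.toFun (y : UnitAddCircle) ∉
      {z | ∃ x ∈ Set.Icc p q, ∃ y ∈ Set.Icc p q, x < y ∧ C.toFun (x : UnitAddCircle) = z ∧
        C.toFun (y : UnitAddCircle) = z ∧ (y : UnitAddCircle) ∉ O} := by
  have inj : ∀ u ∈ Set.Icc p q, ∀ v ∈ Set.Icc p q,
      (u : UnitAddCircle) = (v : UnitAddCircle) → u = v := fun u hu v hv =>
    eq_of_coe_eq hu.1 (hu.2.trans_lt hqp) hv.1 (hv.2.trans_lt hqp)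
  have hne := (coe_ne_coe_of_lt hxy (by linarith [hx.1, hy.2])).symm
  refine ⟨?_, fun hn => ?_⟩
  · rintro ho ⟨x', hx', y', hy', hlt, h1, h2, hno⟩
    rcases C.eq_or_eq_of_fiber hne h.symm h2 with e | e
    · rw [e] at hno
      exact hno ho
    rcases C.eq_or_eq_of_fiber hne h.symm h1 with e' | e'
    · have := inj _ hy' _ hx e
      have := inj _ hx' _ hy e'
      linarith
    · have := inj _ hy' _ hx e
      have := inj _ hx' _ hx e'
      linarith
  · by_contra ho
    exact hn ⟨x, hx, y, hy, hxy, h, rfl, ho⟩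

/-- Let `O` contain exactly one of the two passes through every crossing, and let it contain all `l`
passes on the arc `[a, b]`. If there are `l + k` crossings, then exchanging the passes at no more
than `k / 2` of them makes `O` consist of all first passes, or of all last passes, along an arc
`[p, q]` that contains all passes. The first choice is an arc starting at `a`, the second one
an arc ending at `b`. Neither affects the crossings on `[a, b]`; at every other crossing
the two choices agree on which pass comes first, so exactly one of them requires
an exchange there. -/
theorem PlaneCurve.exists_few_exchanges (C : PlaneCurve) {O : Set UnitAddCircle}
    (hO : ∀ s t : UnitAddCircle, s ≠ t → C.toFun s = C.toFun t → (s ∈ O ↔ t ∉ O))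
    {a b : ℝ} (hab : a ≤ b) {l k : ℕ}
    (hl : (((fun x : ℝ => (x : UnitAddCircle)) '' Set.Icc a b) ∩ C.passes).encard = l)
    (hB : ((fun x : ℝ => (x : UnitAddCircle)) '' Set.Icc a b) ∩ C.passes ⊆ O)
    (hk : C.crossings.ncard = l + k) :
    ∃ S ⊆ C.crossings, S.encard ≤ ((k / 2 : ℕ) : ℕ∞) ∧ ∃ p q : ℝ, p < q ∧ q < p + 1 ∧
      C.passes ⊆ (fun x : ℝ => (x : UnitAddCircle)) '' Set.Icc p q ∧
      ((∀ x ∈ Set.Icc p q, ∀ y ∈ Set.Icc p q, x < y →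
          C.toFun (x : UnitAddCircle) = C.toFun (y : UnitAddCircle) →
          ((x : UnitAddCircle) ∈ O ↔ C.toFun (x : UnitAddCircle) ∉ S)) ∨
        (∀ x ∈ Set.Icc p q, ∀ y ∈ Set.Icc p q, x < y →
          C.toFun (x : UnitAddCircle) = C.toFun (y : UnitAddCircle) →
          ((y : UnitAddCircle) ∈ O ↔ C.toFun (y : UnitAddCircle) ∉ S))) := by
  obtain ⟨ε, hε0, hε1, hε⟩ := exists_punctured_ball_coe_notMem C.finite_passes a
  obtain ⟨δ, hδ0, hδ1, hδ⟩ := exists_punctured_ball_coe_notMem C.finite_passes b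
  have hfin : C.crossings.Finite := C.finite_crossings
  set B := ((fun x : ℝ => (x : UnitAddCircle)) '' Set.Icc a b) ∩ C.passes with hBdef
  set S₁ : Set ℂ := {z | ∃ x ∈ Set.Icc a (a + 1 - ε), ∃ y ∈ Set.Icc a (a + 1 - ε), x < y ∧
    C.toFun (x : UnitAddCircle) = z ∧ C.toFun (y : UnitAddCircle) = z ∧
    (x : UnitAddCircle) ∉ O} with hS₁
  set S₂ : Set ℂ := {z | ∃ x ∈ Set.Icc (b + δ - 1) b, ∃ y ∈ Set.Icc (b + δ - 1) b, x < y ∧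
    C.toFun (x : UnitAddCircle) = z ∧ C.toFun (y : UnitAddCircle) = z ∧
    (y : UnitAddCircle) ∉ O} with hS₂
  -- The passes through a crossing in `S₁` lie behind the bridge, those through a crossing in
  -- `S₂` lie before it.
  have h₁ : ∀ z ∈ S₁, ∃ x y : ℝ, b < x ∧ x < y ∧ y < a + 1 ∧ C.toFun (x : UnitAddCircle) = z ∧
      C.toFun (y : UnitAddCircle) = z ∧ (x : UnitAddCircle) ∉ O := by
    rintro z ⟨x, hx, y, hy, hxy, hxz, hyz, hxO⟩
    refine ⟨x, y, ?_, hxy, by linarith [hy.2], hxz, hyz, hxO⟩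
    by_contra! hxb
    exact hxO (hB ⟨⟨x, ⟨hx.1, hxb⟩, rfl⟩, _,
      (coe_ne_coe_of_lt hxy (by linarith [hx.1, hy.2])).symm, hyz.trans hxz.symm⟩)
  have h₂ : ∀ z ∈ S₂, ∃ x y : ℝ, b - 1 < x ∧ x < y ∧ y < a ∧ C.toFun (x : UnitAddCircle) = z ∧
      C.toFun (y : UnitAddCircle) = z ∧ (y : UnitAddCircle) ∉ O := by
    rintro z ⟨x, hx, y, hy, hxy, hxz, hyz, hyO⟩
    refine ⟨x, y, by linarith [hx.1], hxy, ?_, hxz, hyz, hyO⟩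
    by_contra! hya
    exact hyO (hB ⟨⟨y, ⟨hya, hy.2⟩, rfl⟩, _,
      coe_ne_coe_of_lt hxy (by linarith [hx.1, hy.2]), hxz.trans hyz.symm⟩)
  have hS₁C : S₁ ⊆ C.crossings := by
    intro z hz
    obtain ⟨x, y, hx, hxy, hy, hxz, hyz, -⟩ := h₁ z hz
    exact ⟨_, _, coe_ne_coe_of_lt hxy (by linarith), hxz, hyz⟩
  have hS₂C : S₂ ⊆ C.crossings := by
    intro z hz
    obtain ⟨x, y, hx, hxy, hy, hxz, hyz, -⟩ := h₂ z hz
    exact ⟨_, _, coe_ne_coe_of_lt hxy (by linarith), hxz, hyz⟩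
  have hBC : C.toFun '' B ⊆ C.crossings := by
    rintro _ ⟨u, ⟨-, s, hs, h⟩, rfl⟩
    exact ⟨s, u, hs, h, rfl⟩
  have hdisj : Disjoint S₁ S₂ := by
    rw [Set.disjoint_left]
    intro z hz1 hz2
    obtain ⟨x, y, hx, hxy, hy, hxz, hyz, hxO⟩ := h₁ z hz1
    obtain ⟨x', y', hx', hxy', hy', hxz', hyz', hyO'⟩ := h₂ z hz2
    have hne := coe_ne_coe_of_lt hxy (by linarith)
    have hne' := coe_ne_coe_of_lt hxy' (by linarith)
    have hyO : (y : UnitAddCircle) ∈ O := (hO _ _ hne.symm (hyz.trans hxz.symm)).2 hxO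
    have hxO' : (x' : UnitAddCircle) ∈ O := (hO _ _ hne' (hxz'.trans hyz'.symm)).2 hyO'
    have e1 : (y' : UnitAddCircle) = x :=
      (C.eq_or_eq_of_fiber hne (hxz.trans hyz.symm) (hyz'.trans hxz.symm)).resolve_right
        fun e => hyO' (e ▸ hyO)
    have e2 : (x' : UnitAddCircle) = y :=
      (C.eq_or_eq_of_fiber hne (hxz.trans hyz.symm) (hxz'.trans hxz.symm)).resolve_left
        fun e => hxO (e ▸ hxO')
    -- A full turn carries the pair of passes before the bridge to the pair behind it, but it would
    -- have to reverse their order.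
    rw [← AddCircle.coe_add_period] at e1 e2
    have := eq_of_coe_eq (c := b) (by linarith) (by linarith) (by linarith) (by linarith) e1
    have := eq_of_coe_eq (c := b) (by linarith) (by linarith) (by linarith) (by linarith) e2
    linarith
  have hdisjB : Disjoint (S₁ ∪ S₂) (C.toFun '' B) := by
    rw [Set.disjoint_right]
    rintro _ ⟨_, ⟨⟨u, hu, rfl⟩, -⟩, rfl⟩ (hz | hz)
    · obtain ⟨x, y, hx, hxy, hy, hxz, hyz, -⟩ := h₁ _ hz
      have hne := coe_ne_coe_of_lt hxy (by linarith [hu.1, hu.2])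
      rcases C.eq_or_eq_of_fiber hne (hxz.trans hyz.symm) hxz.symm with e | e
      all_goals
        have := eq_of_coe_eq (c := a) hu.1 (by linarith [hu.2]) (by linarith [hu.1, hu.2])
          (by linarith) e
        linarith [hu.2]
    · obtain ⟨x, y, hx, hxy, hy, hxz, hyz, -⟩ := h₂ _ hz
      have hne := coe_ne_coe_of_lt hxy (by linarith [hu.1, hu.2])
      rcases C.eq_or_eq_of_fiber hne (hxz.trans hyz.symm) hxz.symm with e | e
      all_goals
        have := eq_of_coe_eq (c := x) (by linarith [hu.1]) (by linarith [hu.2]) (by linarith)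
          (by linarith [hu.1, hu.2]) e
        linarith [hu.1]
  -- The bridge passes through each of its crossings only once, so it has `l` crossings.
  have hcard : S₁.ncard + S₂.ncard ≤ k := by
    have hinj : Set.InjOn C.toFun B := by
      intro u hu v hv huv
      by_contra hne
      exact (hO u v hne huv).1 (hB hu) (hB hv)
    have hBcard : (C.toFun '' B).ncard = l := by
      rw [hinj.ncard_image, Set.ncard_def, hl, ENat.toNat_natCast]
    have h := Set.ncard_le_ncard (Set.union_subset (Set.union_subset hS₁C hS₂C) hBC) hfin
    rw [Set.ncard_union_eq hdisjB ((hfin.subset hS₁C).union (hfin.subset hS₂C))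
      (hfin.subset hBC), Set.ncard_union_eq hdisj (hfin.subset hS₁C) (hfin.subset hS₂C),
      hBcard, hk] at h
    omega
  rcases le_total S₁.ncard S₂.ncard with hle | hle
  · refine ⟨S₁, hS₁C, ?_, a, a + 1 - ε, by linarith, by linarith, ?_,
      Or.inl fun x hx y hy hxy h => C.first_mem_iff (by linarith) hx hy hxy h⟩
    · rw [← (hfin.subset hS₁C).cast_ncard_eq]
      exact_mod_cast (by omega : S₁.ncard ≤ k / 2)
    · intro t ht
      obtain ⟨x, hx, rfl⟩ : t ∈ (fun x : ℝ => (x : UnitAddCircle)) '' Set.Ico a (a + 1) := by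
        rw [AddCircle.coe_image_Ico_eq]
        trivial
      refine ⟨x, ⟨hx.1, ?_⟩, rfl⟩
      by_contra! hxε
      refine hε (x - 1) (by rw [abs_lt]; constructor <;> linarith [hx.2]) (by linarith [hx.2]) ?_
      rwa [← AddCircle.coe_add_period, sub_add_cancel]
  · refine ⟨S₂, hS₂C, ?_, b + δ - 1, b, by linarith, by linarith, ?_,
      Or.inr fun x hx y hy hxy h => C.last_mem_iff (by linarith) hx hy hxy h⟩
    · rw [← (hfin.subset hS₂C).cast_ncard_eq]
      exact_mod_cast (by omega : S₂.ncard ≤ k / 2)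
    · intro t ht
      obtain ⟨x, hx, rfl⟩ :
          t ∈ (fun x : ℝ => (x : UnitAddCircle)) '' Set.Ioc (b - 1) (b - 1 + 1) := by
        rw [AddCircle.coe_image_Ioc_eq]
        trivial
      refine ⟨x, ⟨?_, by linarith [hx.2]⟩, rfl⟩
      by_contra! hxδ
      refine hδ (x + 1) (by rw [abs_lt]; constructor <;> linarith [hx.1]) (by linarith [hx.1]) ?_
      rwa [AddCircle.coe_add_period]

end KnotDiagram

theorem mainTheorem3 (K : KnotDiagram.Knot) (D : KnotDiagram.Diagram) (hD : D.IsDiagramOf K)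
    (l k : ℕ) (hbridge : D.HasBridge l) (hl : D.crossingNumber = l + k) :
    KnotDiagram.unknottingNumber K ≤ ((k / 2 : ℕ) : ℕ∞) := by
  obtain ⟨a, b, hab, -, hcard, hB | hB⟩ := hbridge
  · obtain ⟨S, hS, hSk, p, q, hpq, hqp, hpass, h⟩ :=
      D.exists_few_exchanges D.overs_iff hab hcard hB hl
    refine sInf_le_of_le ⟨D, hD, S, hS, rfl, ?_⟩ hSk
    refine (D.switch S).isDiagramOf_unknot hpq hqp hpass ?_
    refine h.imp (fun h x hx y hy hxy e => ?_) (fun h x hx y hy hxy e => ?_)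
    · exact ⟨⟨_, (KnotDiagram.coe_ne_coe_of_lt hxy (by linarith [hx.1, hy.2])).symm, e.symm⟩,
        h x hx y hy hxy e⟩
    · exact ⟨⟨_, KnotDiagram.coe_ne_coe_of_lt hxy (by linarith [hx.1, hy.2]), e⟩, h x hx y hy hxy e⟩
  · have hO : ∀ s t : UnitAddCircle, s ≠ t → D.toFun s = D.toFun t →
        (s ∈ D.passes \ D.overs ↔ t ∉ D.passes \ D.overs) := by
      intro s t hst e
      have hs : s ∈ D.passes := ⟨t, hst.symm, e.symm⟩
      have ht : t ∈ D.passes := ⟨s, hst, e⟩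
      have := D.overs_iff s t hst e
      simp only [Set.mem_sdiff, hs, ht, true_and]
      tauto
    obtain ⟨S, hS, hSk, p, q, hpq, hqp, hpass, h⟩ := D.exists_few_exchanges hO hab hcard hB hl
    refine sInf_le_of_le ⟨D, hD, S, hS, rfl, ?_⟩ hSk
    refine (D.switch S).isDiagramOf_unknot hpq hqp hpass ?_
    -- Now the first passes, or the last passes, are the underpasses.
    refine h.symm.imp (fun h x hx y hy hxy e => ?_) (fun h x hx y hy hxy e => ?_)
    all_goals
      replace e : D.toFun (x : UnitAddCircle) = D.toFun (y : UnitAddCircle) := e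
      have hne := KnotDiagram.coe_ne_coe_of_lt hxy (by linarith [hx.1, hy.2])
      have hx' : (x : UnitAddCircle) ∈ D.passes := ⟨_, hne.symm, e.symm⟩
      have hy' : (y : UnitAddCircle) ∈ D.passes := ⟨_, hne, e⟩
      have h1 := h x hx y hy hxy e
      have h2 := D.overs_iff _ _ hne e
      simp only [Set.mem_sdiff, hx', hy', true_and, ← e] at h1
    · exact ⟨hx', by tauto⟩
    · refine ⟨hy', ?_⟩
      rw [← e]
      tauto
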